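/- Let $X\subset\mathbb{R}^n$ be open and let $f\colon X\to\mathbb{R}^n$ be a $C^1$ vector field such that the system $\dot x=f(x)$ is cooperative, i.e. $\frac{\partial f^i}{\partial x^j}(x)\ge 0$ for all $i\neq j$ and all $x\in X$, and irreducible, i.e. for each $x\in X$ the matrix $\big[\frac{\partial f^i}{\partial x^j}(x)\big]$ is irreducible (there is no partition of the indices into two nonempty classes $S,S'$ such that all entries with row index in $S$ and column index in $S'$ vanish). For $x\in X$ let $t\mapsto\phi_t x$, $t\in(\sigma(x),\tau(x))$, denote the nonextendible solution with $\phi_0x=x$. Assume that the system admits a first integral $H\colon X\to\mathbb{R}$ (a continuous function constant on orbits) that is of class $C^1$ and has positive gradient, i.e. $\frac{\partial H}{\partial x^i}(x)>0$ for all $i$ and all $x\in X$. Call $x\in X$ forward nonwandering if for each $\epsilon>0$ and each $0<t<\tau(x)$ there are $y\in X$ with $\tau(y)>t$ and $\theta\in(t,\tau(y))$ such that $\lVert x-y\rVert<\epsilon$ and $\lVert x-\phi_\theta y\rVert<\epsilon$; call it backward nonwandering if for each $\epsilon>0$ and each $\sigma(x)<t<0$ there are $y\in X$ with $\sigma(y)<t$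 and $\theta\in(\sigma(y),t)$ such that $\lVert x-y\rVert<\epsilon$ and $\lVert x-\phi_\theta y\rVert<\epsilon$. Then every point of $X$ that is forward nonwandering or backward nonwandering is an equilibrium, i.e. $\phi_t x=x$ for all $t\in\mathbb{R}$ (equivalently, $f(x)=0$). -/

import Mathlib

open Set

noncomputable section

namespace CoopODE

/-- `ℝⁿ` with the Euclidean norm. -/
abbrev Euc (n : ℕ) : Type := EuclideanSpace ℝ (Fin n)

variable {n : ℕ}

/-- The Jacobian matrix `[∂fⁱ/∂xʲ (x)]`. -/
def jacobian (f : Euc n → Euc n) (x : Euc n) : Matrix (Fin n) (Fin n) ℝ :=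
  Matrix.of fun i j => (fderiv ℝ f x (EuclideanSpace.single j 1)) i

/-- The system `ẋ = f(x)` on `X` is cooperative: all off-diagonal entries of its Jacobian matrix
are nonnegative. -/
def IsCooperative (X : Set (Euc n)) (f : Euc n → Euc n) : Prop :=
  ∀ x ∈ X, ∀ i j, i ≠ j → 0 ≤ jacobian f x i j

/-- A square matrix is irreducible if the indices cannot be split into two nonempty classes
`S` and `Sᶜ` such that all entries with row in `S` and column in `Sᶜ` vanish. (No sign condition is
put on the entries; the diagonal plays no role, and `1 × 1` matrices are irreducible.) -/
def IsIrreducibleMatrix (A : Matrix (Fin n) (Fin n) ℝ) : Prop :=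
  ∀ S : Set (Fin n), S.Nonempty → Sᶜ.Nonempty → ∃ i ∈ S, ∃ j ∈ Sᶜ, A i j ≠ 0

/-- The Jacobian matrix of `f` is irreducible at each point of `X`. -/
def IsIrreducibleSystem (X : Set (Euc n)) (f : Euc n → Euc n) : Prop :=
  ∀ x ∈ X, IsIrreducibleMatrix (jacobian f x)

/-- `γ` is, on the open interval `J ∋ 0`, a solution of `ẋ = f(x)` in `X` with `γ 0 = x`. -/
structure IsSolutionOn (X : Set (Euc n)) (f : Euc n → Euc n) (x : Euc n)
    (J : Set ℝ) (γ : ℝ → Euc n) : Prop where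
  isOpen : IsOpen J
  ordConnected : J.OrdConnected
  zero_mem : (0 : ℝ) ∈ J
  initial : γ 0 = x
  mapsTo : MapsTo γ J X
  isIntegralCurveOn : IsIntegralCurveOn γ (fun _ => f) J

/-- The domain `(σ(x), τ(x))` of the nonextendible solution starting at `x`: the union of all open
intervals around `0` on which a solution starting at `x` exists. -/
def maxInterval (X : Set (Euc n)) (f : Euc n → Euc n) (x : Euc n) : Set ℝ :=
  {t | ∃ J γ, IsSolutionOn X f x J γ ∧ t ∈ J}

/-- The upper end `τ(x)`, possibly `∞`, of the domain of the nonextendible solution. -/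
def exitTime (X : Set (Euc n)) (f : Euc n → Euc n) (x : Euc n) : EReal :=
  sSup ((fun t : ℝ => (t : EReal)) '' maxInterval X f x)

/-- The lower end `σ(x)`, possibly `-∞`, of the domain of the nonextendible solution. -/
def entryTime (X : Set (Euc n)) (f : Euc n → Euc n) (x : Euc n) : EReal :=
  sInf ((fun t : ℝ => (t : EReal)) '' maxInterval X f x)

open Classical in
/-- The local flow `φ_t x`: the value at time `t` of a solution starting at `x` that is defined at
`t`. For a `C¹` vector field on an open set all such solutions agree at `t`. Outside the domain
of the nonextendible solution the value is irrelevant (and set to `x`). -/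
def flow (X : Set (Euc n)) (f : Euc n → Euc n) (t : ℝ) (x : Euc n) : Euc n :=
  if h : t ∈ maxInterval X f x then h.choose_spec.choose t else x

/-- `x` is an equilibrium: its trajectory is defined for all times and is constant. -/
def IsEquilibrium (X : Set (Euc n)) (f : Euc n → Euc n) (x : Euc n) : Prop :=
  x ∈ X ∧ ∀ t : ℝ, t ∈ maxInterval X f x ∧ flow X f t x = x

/-- `x` is forward nonwandering. -/
def IsForwardNonwandering (X : Set (Euc n)) (f : Euc n → Euc n) (x : Euc n) : Prop :=
  x ∈ X ∧ ∀ ε : ℝ, 0 < ε → ∀ t : ℝ, 0 < t → (t : EReal) < exitTime X f x →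
    ∃ y ∈ X, (t : EReal) < exitTime X f y ∧
      ∃ θ : ℝ, t < θ ∧ (θ : EReal) < exitTime X f y ∧
        ‖x - y‖ < ε ∧ ‖x - flow X f θ y‖ < ε

/-- `x` is backward nonwandering. -/
def IsBackwardNonwandering (X : Set (Euc n)) (f : Euc n → Euc n) (x : Euc n) : Prop :=
  x ∈ X ∧ ∀ ε : ℝ, 0 < ε → ∀ t : ℝ, t < 0 → entryTime X f x < (t : EReal) →
    ∃ y ∈ X, entryTime X f y < (t : EReal) ∧
      ∃ θ : ℝ, entryTime X f y < (θ : EReal) ∧ θ < t ∧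
        ‖x - y‖ < ε ∧ ‖x - flow X f θ y‖ < ε

/-- `x` is nonwandering: forward nonwandering or backward nonwandering. -/
def IsNonwandering (X : Set (Euc n)) (f : Euc n → Euc n) (x : Euc n) : Prop :=
  IsForwardNonwandering X f x ∨ IsBackwardNonwandering X f x

/-- `H` is a first integral on `X`: it is continuous and constant on orbits. -/
def IsFirstIntegral (X : Set (Euc n)) (f : Euc n → Euc n) (H : Euc n → ℝ) : Prop :=
  ContinuousOn H X ∧ ∀ x ∈ X, ∀ t ∈ maxInterval X f x, H (flow X f t x) = H x

/-- At each point of `X` all coordinates of the gradient of `H` are positive. -/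
def HasPositiveGradient (X : Set (Euc n)) (H : Euc n → ℝ) : Prop :=
  ∀ x ∈ X, ∀ i, 0 < (gradient H x) i

end CoopODE

end

open Filter Topology

/-! The Finsler length of the velocity, V = ∑ ∂ᵢH |fⁱ|, is a strict Lyapunov function off the
equilibria. Along a solution u = f(γ) satisfies u' = Au with A the Jacobian, while p = ∇H satisfies
the adjoint equation p' = -Aᵀp (`hasDerivAt_fderiv_firstIntegral`). The right derivative of V is
therefore ∑ pᵢ(D⁺|uᵢ| - ∑ⱼ Aᵢⱼ|uⱼ|), where each bracket is ≤ 0 because A is cooperative and p > 0.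

Since p · u = 0, a nonzero u has components of both signs, and irreducibility then makes one bracket
negative (`exists_absDeriv_lt`), at least at times when the zero components of u have zero
derivative; such times occur in every interval. So V drops strictly in any positive time
(`weightedSpeed_lt`). By continuity the drop persists for nearby orbits, which then cannot return
close to their start. -/

namespace CoopODE

variable {n : ℕ} {X : Set (Euc n)} {f : Euc n → Euc n} {H : Euc n → ℝ}

/-! ### Uniqueness of solutions and the local flow -/

namespace IsSolutionOn

variable {x : Euc n} {J J' : Set ℝ} {γ γ' : ℝ → Euc n}

theorem hasDerivAt (h : IsSolutionOn X f x J γ) {t : ℝ} (ht : t ∈ J) :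
    HasDerivAt γ (f (γ t)) t :=
  (h.isIntegralCurveOn t ht).hasDerivAt (h.isOpen.mem_nhds ht)

theorem eventuallyEq (hX : IsOpen X) (hf : ContDiffOn ℝ 1 f X) {x' : Euc n}
    (h : IsSolutionOn X f x J γ) (h' : IsSolutionOn X f x' J' γ') {t : ℝ} (ht : t ∈ J ∩ J')
    (heq : γ t = γ' t) : γ =ᶠ[𝓝 t] γ' := by
  obtain ⟨K, s, hs, hl⟩ :=
    (hf.contDiffAt (hX.mem_nhds (h.mapsTo ht.1))).exists_lipschitzOnWith
  refine ODE_solution_unique_of_eventually (v := fun _ ↦ f) (s := fun _ ↦ s) (K := K)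
    (Eventually.of_forall fun _ ↦ hl) ?_ ?_ heq
  · filter_upwards [h.isOpen.mem_nhds ht.1, (h.hasDerivAt ht.1).continuousAt hs] with r hr hr'
    exact ⟨h.hasDerivAt hr, hr'⟩
  · rw [heq] at hs
    filter_upwards [h'.isOpen.mem_nhds ht.2, (h'.hasDerivAt ht.2).continuousAt hs] with r hr hr'
    exact ⟨h'.hasDerivAt hr, hr'⟩

/-- Solutions with the same initial value agree on their common domain. -/
theorem eqOn (hX : IsOpen X) (hf : ContDiffOn ℝ 1 f X) (h : IsSolutionOn X f x J γ)
    (h' : IsSolutionOn X f x J' γ') : EqOn γ γ' (J ∩ J') := by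
  have hJ : IsPreconnected (J ∩ J') := (h.ordConnected.inter h'.ordConnected).isPreconnected
  have hsub : J ∩ J' ⊆ {t | γ =ᶠ[𝓝 t] γ'} := by
    -- The set where the germs agree is open, and by continuity relatively closed in the connected
    -- common domain.
    refine hJ.subset_of_closure_inter_subset isOpen_setOfPred_eventually_nhds
      ⟨0, ⟨h.zero_mem, h'.zero_mem⟩, ?_⟩ ?_
    · exact h.eventuallyEq hX hf h' ⟨h.zero_mem, h'.zero_mem⟩ (by rw [h.initial, h'.initial])
    · rintro t ⟨htc, ht⟩
      refine h.eventuallyEq hX hf h' ht ?_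
      by_contra hne
      have hev := ((h.hasDerivAt ht.1).continuousAt.sub
        (h'.hasDerivAt ht.2).continuousAt).eventually_ne (sub_ne_zero.2 hne)
      obtain ⟨s, hs, hs'⟩ := ((mem_closure_iff_frequently.1 htc).and_eventually hev).exists
      exact hs' (sub_eq_zero.2 hs.self_of_nhds)
  exact fun t ht ↦ (hsub ht).self_of_nhds

theorem flow_eq (hX : IsOpen X) (hf : ContDiffOn ℝ 1 f X) (h : IsSolutionOn X f x J γ) {t : ℝ}
    (ht : t ∈ J) : flow X f t x = γ t := by
  have hmem : t ∈ maxInterval X f x := ⟨J, γ, h, ht⟩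
  rw [flow, dif_pos hmem]
  have hs := hmem.choose_spec.choose_spec
  exact hs.1.eqOn hX hf h ⟨hs.2, ht⟩

/-- Restarting a solution at a later or earlier time. -/
theorem shift (h : IsSolutionOn X f x J γ) {s : ℝ} (hs : s ∈ J) :
    IsSolutionOn X f (γ s) ((fun t ↦ t + s) ⁻¹' J) (fun t ↦ γ (t + s)) where
  isOpen := h.isOpen.preimage (by fun_prop)
  ordConnected := h.ordConnected.preimage_mono fun a b hab ↦ by simpa using hab
  zero_mem := by simpa using hs
  initial := by simp
  mapsTo := fun t ht ↦ h.mapsTo ht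
  isIntegralCurveOn := fun t ht ↦
    ((h.hasDerivAt (t := t + s) ht).comp_add_const t s).hasDerivWithinAt

theorem lt_exitTime (h : IsSolutionOn X f x J γ) {t : ℝ} (ht : t ∈ J) :
    (t : EReal) < exitTime X f x := by
  obtain ⟨s, hs, hts⟩ : (J ∩ Ioi t).Nonempty := (𝓝[>] t).nonempty_of_mem
    (inter_mem (mem_nhdsWithin_of_mem_nhds (h.isOpen.mem_nhds ht)) self_mem_nhdsWithin)
  exact (EReal.coe_lt_coe_iff.2 hts).trans_le (le_sSup ⟨s, ⟨J, γ, h, hs⟩, rfl⟩)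

theorem entryTime_lt (h : IsSolutionOn X f x J γ) {t : ℝ} (ht : t ∈ J) :
    entryTime X f x < (t : EReal) := by
  obtain ⟨s, hs, hts⟩ : (J ∩ Iio t).Nonempty := (𝓝[<] t).nonempty_of_mem
    (inter_mem (mem_nhdsWithin_of_mem_nhds (h.isOpen.mem_nhds ht)) self_mem_nhdsWithin)
  have hmem : s ∈ maxInterval X f x := ⟨J, γ, h, hs⟩
  exact (sInf_le (mem_image_of_mem _ hmem)).trans_lt (EReal.coe_lt_coe_iff.2 hts)

end IsSolutionOn

theorem exists_isSolutionOn_of_lt_exitTime {x : Euc n} {t : ℝ} (ht : 0 ≤ t)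
    (h : (t : EReal) < exitTime X f x) : ∃ J γ, IsSolutionOn X f x J γ ∧ t ∈ J := by
  obtain ⟨_, ⟨s, ⟨J, γ, hγ, hs⟩, rfl⟩, hts⟩ := lt_sSup_iff.1 h
  exact ⟨J, γ, hγ, hγ.ordConnected.out hγ.zero_mem hs ⟨ht, (EReal.coe_lt_coe_iff.1 hts).le⟩⟩

theorem exists_isSolutionOn_of_entryTime_lt {x : Euc n} {t : ℝ} (ht : t ≤ 0)
    (h : entryTime X f x < (t : EReal)) : ∃ J γ, IsSolutionOn X f x J γ ∧ t ∈ J := by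
  obtain ⟨_, ⟨s, ⟨J, γ, hγ, hs⟩, rfl⟩, hts⟩ := sInf_lt_iff.1 h
  exact ⟨J, γ, hγ, hγ.ordConnected.out hs hγ.zero_mem ⟨(EReal.coe_lt_coe_iff.1 hts).le, ht⟩⟩

/-- A local flow around a point of `X`, continuous in the initial value. -/
theorem exists_local_flow (hX : IsOpen X) (hf : ContDiffOn ℝ 1 f X) {x : Euc n} (hx : x ∈ X) :
    ∃ δ > 0, ∃ α : Euc n → ℝ → Euc n,
      (∀ᶠ y in 𝓝 x, IsSolutionOn X f y (Ioo (-δ) δ) (α y)) ∧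
      ∀ t ∈ Ioo (-δ) δ, ContinuousAt (fun y ↦ α y t) x := by
  obtain ⟨ε, hε, a, r, L, K, hr, hpl⟩ :=
    IsPicardLindelof.of_contDiffAt_one (hf.contDiffAt (hX.mem_nhds hx))
  obtain ⟨α, hα, hc⟩ := (hpl 0).exists_forall_mem_closedBall_eq_hasDerivWithinAt_continuousOn
  have hr' : (0 : ℝ) < r := hr
  have hnhds : ∀ t ∈ Ioo (-ε) ε,
      Metric.closedBall x (r : ℝ) ×ˢ Icc (0 - ε) (0 + ε) ∈ 𝓝 (x, t) := fun t ht ↦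
    prod_mem_nhds (Metric.closedBall_mem_nhds x hr')
      (Icc_mem_nhds (by linarith [ht.1]) (by linarith [ht.2]))
  have hcont : ∀ t ∈ Ioo (-ε) ε, ContinuousAt α (x, t) := fun t ht ↦ hc.continuousAt (hnhds t ht)
  have h0 : α (x, 0) = x := (hα x (Metric.mem_closedBall_self hr'.le)).1
  -- Picard–Lindelöf alone does not keep solutions in `X`; joint continuity at `(x, 0)` does so for
  -- a short time common to all nearby initial values.
  have hmem : ∀ᶠ q in 𝓝 (x, (0 : ℝ)), α q ∈ X :=
    (hcont 0 ⟨by linarith, hε⟩).eventually (by rw [h0]; exact hX.mem_nhds hx)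
  rw [nhds_prod_eq, eventually_prod_iff] at hmem
  obtain ⟨p, hp, q, hq, hpq⟩ := hmem
  obtain ⟨δ', hδ', hball⟩ := Metric.eventually_nhds_iff_ball.1 hq
  have hsub : Ioo (-min δ' ε) (min δ' ε) ⊆ Ioo (-ε) ε :=
    Ioo_subset_Ioo (neg_le_neg (min_le_right _ _)) (min_le_right _ _)
  refine ⟨min δ' ε, lt_min hδ' hε, fun y t ↦ α (y, t), ?_, fun t ht ↦ ?_⟩
  · filter_upwards [hp, Metric.closedBall_mem_nhds x hr'] with y hy hyr
    refine ⟨isOpen_Ioo, ordConnected_Ioo, by simp [hδ', hε], (hα y hyr).1, fun t ht ↦ ?_,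
      fun t ht ↦ ?_⟩
    · refine hpq hy (hball t ?_)
      rw [Real.ball_eq_Ioo]
      exact ⟨by linarith [ht.1, min_le_left δ' ε], by linarith [ht.2, min_le_left δ' ε]⟩
    · have ht' := hsub ht
      exact (((hα y hyr).2 t ⟨by linarith [ht'.1], by linarith [ht'.2]⟩).hasDerivAt
        (Icc_mem_nhds (by linarith [ht'.1]) (by linarith [ht'.2]))).hasDerivWithinAt
  · exact (hcont t (hsub ht)).comp (f := fun y ↦ (y, t)) (by fun_prop)

/-! ### Equilibria, and the gradient of a first integral along solutions -/

theorem isEquilibrium_of_eq_zero (hX : IsOpen X) (hf : ContDiffOn ℝ 1 f X) {x : Euc n}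
    (hx : x ∈ X) (hfx : f x = 0) : IsEquilibrium X f x := by
  have h : IsSolutionOn X f x univ (fun _ ↦ x) :=
    ⟨isOpen_univ, ordConnected_univ, mem_univ _, rfl, fun _ _ ↦ hx, fun t _ ↦ by
      simpa [hfx] using hasDerivWithinAt_const t univ x⟩
  exact ⟨hx, fun t ↦ ⟨⟨univ, _, h, mem_univ t⟩, h.flow_eq hX hf (mem_univ t)⟩⟩

/-- A differentiable first integral has derivative zero along the vector field. -/
theorem IsFirstIntegral.fderiv_apply_eq_zero (hX : IsOpen X) (hf : ContDiffOn ℝ 1 f X)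
    (hH : ContDiffOn ℝ 1 H X) (hint : IsFirstIntegral X f H) {x : Euc n} (hx : x ∈ X) :
    fderiv ℝ H x (f x) = 0 := by
  obtain ⟨δ, hδ, α, hα, -⟩ := exists_local_flow hX hf hx
  have hs := hα.self_of_nhds
  have h0 := hs.hasDerivAt hs.zero_mem
  have hHd : HasFDerivAt H (fderiv ℝ H (α x 0)) (α x 0) :=
    ((hH.contDiffAt (hX.mem_nhds (hs.mapsTo hs.zero_mem))).differentiableAt (by simp)).hasFDerivAt
  have h1 := hHd.comp_hasDerivAt 0 h0
  have h2 : H ∘ α x =ᶠ[𝓝 0] fun _ ↦ H x := by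
    filter_upwards [hs.isOpen.mem_nhds hs.zero_mem] with t ht
    have := hint.2 x hx t ⟨_, _, hs, ht⟩
    rwa [hs.flow_eq hX hf ht] at this
  rw [hs.initial] at h1
  exact h1.unique ((hasDerivAt_const 0 (H x)).congr_of_eventuallyEq h2)

/-- Strict differentiability lets the base point move together with the step, which gives the
uniformity needed to interchange limit and derivative below. -/
theorem _root_.HasStrictFDerivAt.tendsto_inv_smul_sub {E F : Type*} [NormedAddCommGroup E]
    [NormedSpace ℝ E] [NormedAddCommGroup F] [NormedSpace ℝ F] {g : E → F} {g' : E →L[ℝ] F}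
    {x : E} (hg : HasStrictFDerivAt g g' x) (v : E) :
    Tendsto (fun q : ℝ × E ↦ q.1⁻¹ • (g (q.2 + q.1 • v) - g q.2)) (𝓝[≠] 0 ×ˢ 𝓝 x)
      (𝓝 (g' v)) := by
  have hle : (𝓝[≠] (0 : ℝ)) ×ˢ 𝓝 x ≤ 𝓝 ((0 : ℝ), x) := by
    rw [nhds_prod_eq]; exact prod_mono_left _ nhdsWithin_le_nhds
  have hc : Tendsto (fun q : ℝ × E ↦ (q.2 + q.1 • v, q.2)) (𝓝[≠] 0 ×ˢ 𝓝 x) (𝓝 (x, x)) := by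
    refine Tendsto.mono_left ?_ hle
    have : Continuous fun q : ℝ × E ↦ (q.2 + q.1 • v, q.2) := by fun_prop
    simpa using this.tendsto ((0 : ℝ), x)
  have h1 := hg.isLittleO.comp_tendsto hc
  have h2 : (fun q : ℝ × E ↦ g (q.2 + q.1 • v) - g q.2 - q.1 • g' v) =o[𝓝[≠] 0 ×ˢ 𝓝 x]
      fun q : ℝ × E ↦ q.1 := by
    refine (h1.congr_left fun q ↦ by simp).trans_isBigO ?_
    refine Asymptotics.IsBigO.of_bound ‖v‖ (Eventually.of_forall fun q ↦ ?_)
    simp [norm_smul, mul_comm]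
  have h3 := h2.tendsto_inv_smul_nhds_zero
  have h4 : ∀ᶠ q : ℝ × E in 𝓝[≠] 0 ×ˢ 𝓝 x, q.1 ≠ 0 :=
    tendsto_fst.eventually self_mem_nhdsWithin
  have h5 := h3.add_const (g' v)
  rw [zero_add] at h5
  refine h5.congr' ?_
  filter_upwards [h4] with q hq
  rw [smul_sub, smul_smul, inv_mul_cancel₀ hq, one_smul, sub_add_cancel]

/-- The adjoint variational equation satisfied by the gradient of a first integral. -/
theorem IsSolutionOn.hasDerivAt_fderiv_firstIntegral (hX : IsOpen X) (hf : ContDiffOn ℝ 1 f X)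
    (hH : ContDiffOn ℝ 1 H X) (hint : IsFirstIntegral X f H) {x : Euc n} {J : Set ℝ}
    {γ : ℝ → Euc n} (h : IsSolutionOn X f x J γ) {t : ℝ} (ht : t ∈ J) (v : Euc n) :
    HasDerivAt (fun s ↦ fderiv ℝ H (γ s) v) (-fderiv ℝ H (γ t) (fderiv ℝ f (γ t) v)) t := by
  have hγc : ContinuousAt γ t := (h.hasDerivAt ht).continuousAt
  have hHd : ∀ y ∈ X, HasFDerivAt H (fderiv ℝ H y) y := fun y hy ↦
    ((hH.contDiffAt (hX.mem_nhds hy)).differentiableAt (by simp)).hasFDerivAt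
  have hXt : X ∈ 𝓝 (γ t) := hX.mem_nhds (h.mapsTo ht)
  have hle : (𝓝[≠] (0 : ℝ)) ×ˢ 𝓝 t ≤ 𝓝 ((0 : ℝ), t) := by
    rw [nhds_prod_eq]; exact prod_mono_left _ nhdsWithin_le_nhds
  have hz : Tendsto (fun q : ℝ × ℝ ↦ γ q.2 + q.1 • v) (𝓝[≠] 0 ×ˢ 𝓝 t) (𝓝 (γ t)) := by
    refine Tendsto.mono_left ?_ hle
    have : ContinuousAt (fun q : ℝ × ℝ ↦ γ q.2 + q.1 • v) (0, t) :=
      ContinuousAt.add (ContinuousAt.comp (f := Prod.snd) hγc continuousAt_snd) (by fun_prop)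
    simpa using this.tendsto
  have hzX : ∀ᶠ q : ℝ × ℝ in 𝓝[≠] 0 ×ˢ 𝓝 t, γ q.2 + q.1 • v ∈ X := hz hXt
  have hJ : ∀ᶠ q : ℝ × ℝ in 𝓝[≠] 0 ×ˢ 𝓝 t, q.2 ∈ J :=
    tendsto_snd.eventually (h.isOpen.mem_nhds ht)
  -- `H` is only C¹, so its gradient cannot be differentiated by the chain rule. Difference
  -- quotients of `H` in direction `v` are differentiated in time instead, and their time
  -- derivatives converge uniformly near `t`.
  refine hasDerivAt_of_tendstoUniformlyOnFilter (l := 𝓝[≠] (0 : ℝ))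
    (f := fun ε s ↦ ε⁻¹ * (H (γ s + ε • v) - H (γ s)))
    (f' := fun ε s ↦ ε⁻¹ * (fderiv ℝ H (γ s + ε • v) (f (γ s))))
    (g' := fun _ ↦ -fderiv ℝ H (γ t) (fderiv ℝ f (γ t) v)) ?_ ?_ ?_
  · rw [← tendsto_prod_filter_iff]
    have h1 : Tendsto (fun q : ℝ × ℝ ↦ fderiv ℝ H (γ q.2 + q.1 • v)) (𝓝[≠] 0 ×ˢ 𝓝 t)
        (𝓝 (fderiv ℝ H (γ t))) :=
      ((hH.contDiffAt hXt).continuousAt_fderiv (by simp)).tendsto.comp hz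
    have h2 : Tendsto (fun q : ℝ × ℝ ↦ q.1⁻¹ • (f (γ q.2 + q.1 • v) - f (γ q.2)))
        (𝓝[≠] 0 ×ˢ 𝓝 t) (𝓝 (fderiv ℝ f (γ t) v)) :=
      (((hf.contDiffAt hXt).hasStrictFDerivAt (by simp)).tendsto_inv_smul_sub v).comp
        (tendsto_id.prodMap hγc.tendsto)
    have h3 : Tendsto (fun q : ℝ × ℝ ↦ fderiv ℝ H (γ q.2 + q.1 • v)
        (q.1⁻¹ • (f (γ q.2 + q.1 • v) - f (γ q.2)))) (𝓝[≠] 0 ×ˢ 𝓝 t)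
        (𝓝 (fderiv ℝ H (γ t) (fderiv ℝ f (γ t) v))) :=
      (isBoundedBilinearMap_apply.continuous.tendsto
        (fderiv ℝ H (γ t), fderiv ℝ f (γ t) v)).comp (h1.prodMk_nhds h2)
    refine h3.neg.congr' ?_
    filter_upwards [hzX] with q hq
    -- As DH(z) f(z) = 0 at the displaced point z, a difference quotient of `f` can be formed inside
    -- DH(z).
    have := hint.fderiv_apply_eq_zero hX hf hH hq
    simp only [map_smul, map_sub, this, smul_eq_mul, Function.HasUncurry.uncurry, id]
    ring
  · filter_upwards [hzX, hJ] with q hq hqJ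
    have hd := h.hasDerivAt hqJ
    have h1 := (hHd _ hq).comp_hasDerivAt q.2 (hd.add_const (q.1 • v))
    have h2 := (hHd _ (h.mapsTo hqJ)).comp_hasDerivAt q.2 hd
    rw [hint.fderiv_apply_eq_zero hX hf hH (h.mapsTo hqJ)] at h2
    simpa using (h1.sub h2).const_mul q.1⁻¹
  · filter_upwards [h.isOpen.mem_nhds ht] with s hs
    exact ((hHd _ (h.mapsTo hs)).hasLineDerivAt v).tendsto_slope_zero

/-! ### Absolute values along linear cooperative systems -/

/-- The right derivative of the absolute value of a differentiable function. -/
theorem _root_.HasDerivAt.hasDerivWithinAt_Ici_abs {w : ℝ → ℝ} {w' t : ℝ}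
    (hw : HasDerivAt w w' t) :
    HasDerivWithinAt (fun s ↦ |w s|) (if w t = 0 then |w'| else SignType.sign (w t) * w')
      (Ici t) t := by
  split_ifs with h0
  · rw [← hasDerivWithinAt_Ioi_iff_Ici, hasDerivWithinAt_iff_tendsto_slope' self_notMem_Ioi]
    have h1 := (hasDerivWithinAt_iff_tendsto_slope' self_notMem_Ioi).1
      (hw.hasDerivWithinAt (s := Ioi t))
    refine h1.abs.congr' ?_
    filter_upwards [self_mem_nhdsWithin] with s hs
    have : 0 < s - t := sub_pos.2 hs
    simp [slope_def_field, h0, abs_div, abs_of_pos this]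
  · exact ((hasDerivAt_abs h0).comp t hw).hasDerivWithinAt

theorem sum_smul_map_single {E : Type*} [AddCommGroup E] [Module ℝ E] [TopologicalSpace E]
    (T : Euc n →L[ℝ] E) (v : Euc n) :
    T v = ∑ j, v j • T (EuclideanSpace.single j 1) := by
  have hv : v = ∑ j, v j • (EuclideanSpace.single j 1 : Euc n) := by
    have := (EuclideanSpace.basisFun (Fin n) ℝ).sum_repr v
    simpa using this.symm
  conv_lhs => rw [hv]
  simp

/-- The right derivative of `|uᵢ|` along `u' = A u`. -/
noncomputable def absDeriv (A : Matrix (Fin n) (Fin n) ℝ) (u : Fin n → ℝ) (i : Fin n) : ℝ :=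
  if u i = 0 then |∑ j, A i j * u j| else SignType.sign (u i) * ∑ j, A i j * u j

theorem mul_abs_of_offDiag_nonneg {A : Matrix (Fin n) (Fin n) ℝ}
    (hA : ∀ i j, i ≠ j → 0 ≤ A i j) {u : Fin n → ℝ} {i : Fin n} (hi : u i = 0) (j : Fin n) :
    |A i j * u j| = A i j * |u j| := by
  by_cases hij : i = j
  · subst hij; simp [hi]
  · rw [abs_mul, abs_of_nonneg (hA i j hij)]

theorem sign_mul_le_of_offDiag_nonneg {A : Matrix (Fin n) (Fin n) ℝ}
    (hA : ∀ i j, i ≠ j → 0 ≤ A i j) (u : Fin n → ℝ) (i j : Fin n) :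
    SignType.sign (u i) * (A i j * u j) ≤ A i j * |u j| := by
  by_cases hij : i = j
  · subst hij
    rw [mul_left_comm, sign_mul_self]
  · rw [mul_left_comm]
    refine mul_le_mul_of_nonneg_left ?_ (hA i j hij)
    rcases lt_trichotomy (u i) 0 with h | h | h
    · simpa [h] using neg_le_abs (u j)
    · simp [h]
    · simpa [h] using le_abs_self (u j)

theorem absDeriv_le {A : Matrix (Fin n) (Fin n) ℝ} (hA : ∀ i j, i ≠ j → 0 ≤ A i j)
    (u : Fin n → ℝ) (i : Fin n) : absDeriv A u i ≤ ∑ j, A i j * |u j| := by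
  unfold absDeriv
  split_ifs with h0
  · refine (Finset.abs_sum_le_sum_abs _ _).trans_eq ?_
    exact Finset.sum_congr rfl fun j _ ↦ mul_abs_of_offDiag_nonneg hA h0 j
  · rw [Finset.mul_sum]
    exact Finset.sum_le_sum fun j _ ↦ sign_mul_le_of_offDiag_nonneg hA u i j

/-- Irreducibility makes one of the inequalities `absDeriv_le` strict, provided that `u` has
components of both signs and `A u` vanishes where `u` does. -/
theorem exists_absDeriv_lt {A : Matrix (Fin n) (Fin n) ℝ} (hA : ∀ i j, i ≠ j → 0 ≤ A i j)
    (hirr : IsIrreducibleMatrix A) {u : Fin n → ℝ} (hpos : ∃ i, 0 < u i) (hneg : ∃ i, u i < 0)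
    (hzero : ∀ i, u i = 0 → ∑ j, A i j * u j = 0) :
    ∃ i, absDeriv A u i < ∑ j, A i j * |u j| := by
  -- With zero components, split them from the rest: a zero row has `absDeriv` 0 but a positive
  -- bound. Otherwise split positive from negative: a negative `u j` feeding a positive row loses by
  -- its sign.
  by_cases hZ : ∃ i, u i = 0
  · obtain ⟨i, hi, j, hj, hij⟩ := hirr {i | u i = 0} hZ (hpos.imp fun i hi ↦ hi.ne')
    have hne : i ≠ j := fun h ↦ hj (h ▸ hi)
    refine ⟨i, ?_⟩
    have hi' : u i = 0 := hi
    rw [absDeriv, if_pos hi', hzero i hi', abs_zero]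
    refine Finset.sum_pos' (fun k _ ↦ ?_) ⟨j, Finset.mem_univ j, ?_⟩
    · rw [← mul_abs_of_offDiag_nonneg hA hi k]; exact abs_nonneg _
    · exact mul_pos ((hA i j hne).lt_of_ne' hij) (abs_pos.2 hj)
  · push Not at hZ
    obtain ⟨i, hi, j, hj, hij⟩ := hirr {i | 0 < u i} hpos (hneg.imp fun i hi ↦ hi.le.not_gt)
    have hne : i ≠ j := fun h ↦ hj (h ▸ hi)
    have hi' : 0 < u i := hi
    have hj1 : ¬0 < u j := hj
    have hj' : u j < 0 := (not_lt.1 hj1).lt_of_ne (hZ j)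
    refine ⟨i, ?_⟩
    rw [absDeriv, if_neg (hZ i), Finset.mul_sum]
    refine Finset.sum_lt_sum (fun k _ ↦ sign_mul_le_of_offDiag_nonneg hA u i k)
      ⟨j, Finset.mem_univ j, ?_⟩
    have hp := (hA i j hne).lt_of_ne' hij
    simp only [sign_pos hi', SignType.coe_one, one_mul]
    exact mul_lt_mul_of_pos_left (hj'.trans_le (abs_nonneg _)) hp

/-! ### The weighted speed and its decay -/

/-- The Finsler length `∑ᵢ ∂H/∂xⁱ |fⁱ|` of the vector field. -/
noncomputable def weightedSpeed (f : Euc n → Euc n) (H : Euc n → ℝ) (y : Euc n) : ℝ :=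
  ∑ i, fderiv ℝ H y (EuclideanSpace.single i 1) * |f y i|

theorem continuousAt_weightedSpeed (hX : IsOpen X) (hf : ContDiffOn ℝ 1 f X)
    (hH : ContDiffOn ℝ 1 H X) {x : Euc n} (hx : x ∈ X) : ContinuousAt (weightedSpeed f H) x := by
  have h1 : ContinuousAt (fderiv ℝ H) x :=
    (hH.contDiffAt (hX.mem_nhds hx)).continuousAt_fderiv (by simp)
  have h2 : ContinuousAt f x := (hf.contDiffAt (hX.mem_nhds hx)).continuousAt
  unfold weightedSpeed
  fun_prop

theorem HasPositiveGradient.fderiv_single_pos (hgrad : HasPositiveGradient X H) {x : Euc n}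
    (hx : x ∈ X) (i : Fin n) : 0 < fderiv ℝ H x (EuclideanSpace.single i 1) := by
  rw [← toDual_gradient, InnerProductSpace.toDual_apply_apply, EuclideanSpace.inner_single_right]
  simpa using hgrad x hx i

theorem exists_pos_and_exists_neg_of_sum_mul_eq_zero {p u : Fin n → ℝ} (hp : ∀ i, 0 < p i)
    (hu : ∃ i, u i ≠ 0) (h : ∑ i, u i * p i = 0) : (∃ i, 0 < u i) ∧ ∃ i, u i < 0 := by
  obtain ⟨k, hk⟩ := hu
  constructor
  · by_contra! hle
    refine hk (mul_left_injective₀ (hp k).ne' ?_)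
    simpa using (Finset.sum_eq_zero_iff_of_nonpos fun i _ ↦
      mul_nonpos_of_nonpos_of_nonneg (hle i) (hp i).le).1 h k (Finset.mem_univ k)
  · by_contra! hge
    refine hk (mul_left_injective₀ (hp k).ne' ?_)
    simpa using (Finset.sum_eq_zero_iff_of_nonneg fun i _ ↦
      mul_nonneg (hge i) (hp i).le).1 h k (Finset.mem_univ k)

namespace IsSolutionOn

variable {x : Euc n} {J : Set ℝ} {γ : ℝ → Euc n}

theorem hasDerivAt_vectorField_apply (hX : IsOpen X) (hf : ContDiffOn ℝ 1 f X)
    (h : IsSolutionOn X f x J γ) {t : ℝ} (ht : t ∈ J) (i : Fin n) :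
    HasDerivAt (fun s ↦ f (γ s) i) (∑ j, jacobian f (γ t) i j * f (γ t) j) t := by
  have hfd : HasFDerivAt f (fderiv ℝ f (γ t)) (γ t) :=
    ((hf.contDiffAt (hX.mem_nhds (h.mapsTo ht))).differentiableAt (by simp)).hasFDerivAt
  have h1 := (EuclideanSpace.proj (𝕜 := ℝ) i).hasFDerivAt.comp_hasDerivAt t
    (hfd.comp_hasDerivAt t (h.hasDerivAt ht))
  refine h1.congr_deriv ?_
  rw [sum_smul_map_single (fderiv ℝ f (γ t)) (f (γ t))]
  simp [jacobian, mul_comm]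

theorem hasDerivWithinAt_weightedSpeed (hX : IsOpen X) (hf : ContDiffOn ℝ 1 f X)
    (hH : ContDiffOn ℝ 1 H X) (hint : IsFirstIntegral X f H) (h : IsSolutionOn X f x J γ) {t : ℝ}
    (ht : t ∈ J) :
    HasDerivWithinAt (fun s ↦ weightedSpeed f H (γ s))
      (∑ i, fderiv ℝ H (γ t) (EuclideanSpace.single i 1) *
        (absDeriv (jacobian f (γ t)) (f (γ t)) i - ∑ j, jacobian f (γ t) i j * |f (γ t) j|))
      (Ici t) t := by
  have h1 := HasDerivWithinAt.fun_sum (u := Finset.univ) fun i (_ : i ∈ Finset.univ) ↦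
    ((h.hasDerivAt_fderiv_firstIntegral hX hf hH hint ht
      (EuclideanSpace.single i 1)).hasDerivWithinAt (s := Ici t)).fun_mul
      (h.hasDerivAt_vectorField_apply hX hf ht i).hasDerivWithinAt_Ici_abs
  unfold weightedSpeed
  refine h1.congr_deriv ?_
  have h2 : ∀ i : Fin n, fderiv ℝ H (γ t) (fderiv ℝ f (γ t) (EuclideanSpace.single i 1)) =
      ∑ j, jacobian f (γ t) j i * fderiv ℝ H (γ t) (EuclideanSpace.single j 1) := fun i ↦ by
    rw [sum_smul_map_single (fderiv ℝ H (γ t))]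
    rfl
  simp only [h2, Finset.sum_add_distrib, mul_sub, Finset.sum_sub_distrib, neg_mul,
    Finset.sum_neg_distrib, Finset.mul_sum, Finset.sum_mul]
  -- Exchanging the sums moves the transpose from the adjoint equation onto the |uⱼ|.
  rw [Finset.sum_comm, sub_eq_neg_add]
  congr 1
  · exact congrArg Neg.neg (Finset.sum_congr rfl fun i _ ↦ Finset.sum_congr rfl fun j _ ↦ by ring)
  · simp only [absDeriv, Finset.mul_sum]

theorem continuousOn_weightedSpeed (hX : IsOpen X) (hf : ContDiffOn ℝ 1 f X)
    (hH : ContDiffOn ℝ 1 H X) (h : IsSolutionOn X f x J γ) :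
    ContinuousOn (fun s ↦ weightedSpeed f H (γ s)) J := fun _ ht ↦
  ((continuousAt_weightedSpeed hX hf hH (h.mapsTo ht)).comp
    (h.hasDerivAt ht).continuousAt).continuousWithinAt

/-- The weighted speed does not increase along solutions. -/
theorem antitoneOn_weightedSpeed (hX : IsOpen X) (hf : ContDiffOn ℝ 1 f X)
    (hcoop : IsCooperative X f) (hH : ContDiffOn ℝ 1 H X) (hint : IsFirstIntegral X f H)
    (hgrad : HasPositiveGradient X H) (h : IsSolutionOn X f x J γ) :
    AntitoneOn (fun s ↦ weightedSpeed f H (γ s)) J := by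
  intro a ha b hb hab
  have hsub : Icc a b ⊆ J := h.ordConnected.out ha hb
  refine image_le_of_deriv_right_le_deriv_boundary
    (B := fun _ ↦ weightedSpeed f H (γ a)) (B' := fun _ ↦ 0)
    ((h.continuousOn_weightedSpeed hX hf hH).mono hsub)
    (fun t ht ↦ h.hasDerivWithinAt_weightedSpeed hX hf hH hint (hsub (Ico_subset_Icc_self ht)))
    le_rfl continuousOn_const (fun t _ ↦ hasDerivWithinAt_const _ _ _) (fun t ht ↦ ?_)
    (right_mem_Icc.2 hab)
  have htX := h.mapsTo (hsub (Ico_subset_Icc_self ht))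
  exact Finset.sum_nonpos fun i _ ↦ mul_nonpos_of_nonneg_of_nonpos
    (hgrad.fderiv_single_pos htX i).le (sub_nonpos.2 (absDeriv_le (hcoop _ htX) _ i))

/-- In a nonempty open time interval there is an instant near which every component of the velocity
that vanishes there vanishes identically. -/
theorem exists_locally_constant_support (hX : IsOpen X) (hf : ContDiffOn ℝ 1 f X)
    (h : IsSolutionOn X f x J γ) {I : Set ℝ} (hI : IsOpen I) (hIJ : I ⊆ J)
    (hne : ∃ t ∈ I, f (γ t) ≠ 0) :
    ∃ t ∈ I, f (γ t) ≠ 0 ∧ ∀ i, f (γ t) i = 0 → ∀ᶠ s in 𝓝 t, f (γ s) i = 0 := by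
  classical
  let S : ℝ → Finset (Fin n) := fun t ↦ Finset.univ.filter fun i ↦ f (γ t) i ≠ 0
  obtain ⟨t₁, ht₁, hf₁⟩ := hne
  have hIne : I.Nonempty := ⟨t₁, ht₁⟩
  -- Minimizing `n - card` maximizes the support. Nonzero components stay nonzero nearby, so by
  -- maximality no further component can become nonzero there.
  let t := Function.argminOn (fun t ↦ n - (S t).card) I hIne
  have htI : t ∈ I := Function.argminOn_mem _ _ _
  have hmax : ∀ s ∈ I, (S s).card ≤ (S t).card := fun s hs ↦ by
    have h1 : n - (S t).card ≤ n - (S s).card :=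
      Function.argminOn_le (fun t ↦ n - (S t).card) I hs
    have h2 : (S s).card ≤ n := by simpa using (S s).card_le_univ
    have h3 : (S t).card ≤ n := by simpa using (S t).card_le_univ
    omega
  refine ⟨t, htI, fun h0 ↦ hf₁ ?_, fun i hi ↦ ?_⟩
  · have h1 : S t = ∅ := by simp [S, h0]
    have h2 : S t₁ = ∅ := by simpa [h1] using hmax t₁ ht₁
    ext i
    by_contra hi
    have : i ∈ S t₁ := Finset.mem_filter.2 ⟨Finset.mem_univ i, hi⟩
    simp [h2] at this
  · have hsub : ∀ᶠ s in 𝓝 t, S t ⊆ S s := by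
      have : ∀ᶠ s in 𝓝 t, ∀ j, f (γ t) j ≠ 0 → f (γ s) j ≠ 0 := by
        refine eventually_all.2 fun j ↦ ?_
        by_cases hj : f (γ t) j = 0
        · simp [hj]
        · filter_upwards [(h.hasDerivAt_vectorField_apply hX hf
            (hIJ htI) j).continuousAt.eventually_ne hj] with s hs _ using hs
      filter_upwards [this] with s hs j hj
      simp only [S, Finset.mem_filter, Finset.mem_univ, true_and] at hj ⊢
      exact hs j hj
    filter_upwards [hsub, hI.mem_nhds htI] with s hs hsI
    by_contra hne
    have : i ∈ S t := by
      rw [Finset.eq_of_subset_of_card_le hs (hmax s hsI)]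
      exact Finset.mem_filter.2 ⟨Finset.mem_univ i, hne⟩
    exact (Finset.mem_filter.1 this).2 hi

/-- The weighted speed strictly decreases along nonconstant solutions. -/
theorem weightedSpeed_lt (hX : IsOpen X) (hf : ContDiffOn ℝ 1 f X)
    (hcoop : IsCooperative X f) (hirr : IsIrreducibleSystem X f) (hH : ContDiffOn ℝ 1 H X)
    (hint : IsFirstIntegral X f H) (hgrad : HasPositiveGradient X H)
    (h : IsSolutionOn X f x J γ) {a b : ℝ} (ha : a ∈ J) (hb : b ∈ J) (hab : a < b)
    (hfa : f (γ a) ≠ 0) : weightedSpeed f H (γ b) < weightedSpeed f H (γ a) := by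
  by_contra! hle
  have hsub : Icc a b ⊆ J := h.ordConnected.out ha hb
  have hIJ : Ioo a b ⊆ J := Ioo_subset_Icc_self.trans hsub
  have hanti := h.antitoneOn_weightedSpeed hX hf hcoop hH hint hgrad
  have hne : ∃ t ∈ Ioo a b, f (γ t) ≠ 0 := by
    have hc : ContinuousAt (fun s ↦ f (γ s)) a :=
      (hf.contDiffAt (hX.mem_nhds (h.mapsTo ha))).continuousAt.comp
        (h.hasDerivAt ha).continuousAt
    exact ((𝓝[>] a).nonempty_of_mem (inter_mem (Ioo_mem_nhdsGT hab)
      (mem_nhdsWithin_of_mem_nhds (hc.eventually_ne hfa)))).imp fun _ ↦ id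
  obtain ⟨t, ht, hft, hloc⟩ := h.exists_locally_constant_support hX hf isOpen_Ioo hIJ hne
  have htJ := hIJ ht
  have htX := h.mapsTo htJ
  -- A monotone function with no net drop is constant on the interval, so its right derivative at
  -- `t` is 0; strictness will contradict this.
  have hconst : (fun s ↦ weightedSpeed f H (γ s)) =ᶠ[𝓝 t] fun _ ↦ weightedSpeed f H (γ a) := by
    filter_upwards [Ioo_mem_nhds ht.1 ht.2] with s hs
    exact le_antisymm (hanti ha (hIJ hs) hs.1.le) (hle.trans (hanti (hIJ hs) hb hs.2.le))
  have hd := (h.hasDerivWithinAt_weightedSpeed hX hf hH hint htJ)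
  have h0 := ((hasDerivAt_const t (weightedSpeed f H (γ a))).congr_of_eventuallyEq
    hconst).hasDerivWithinAt (s := Ici t)
  have hsum := (uniqueDiffWithinAt_Ici t).eq_deriv _ hd h0
  have hsupp : ∃ i, f (γ t) i ≠ 0 := by
    by_contra! hall
    exact hft (by ext i; exact hall i)
  have hort : ∑ i, f (γ t) i * fderiv ℝ H (γ t) (EuclideanSpace.single i 1) = 0 := by
    rw [← hint.fderiv_apply_eq_zero hX hf hH htX, sum_smul_map_single (fderiv ℝ H (γ t))]
    rfl
  obtain ⟨hpos, hneg⟩ := exists_pos_and_exists_neg_of_sum_mul_eq_zero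
    (hgrad.fderiv_single_pos htX) hsupp hort
  obtain ⟨i, hi⟩ := exists_absDeriv_lt (hcoop _ htX) (hirr _ htX) hpos hneg fun i hi ↦
    (h.hasDerivAt_vectorField_apply hX hf htJ i).unique
      ((hasDerivAt_const t (0 : ℝ)).congr_of_eventuallyEq (hloc i hi))
  refine hsum.not_lt (Finset.sum_neg' (fun j _ ↦ ?_) ⟨i, Finset.mem_univ i, ?_⟩)
  · exact mul_nonpos_of_nonneg_of_nonpos (hgrad.fderiv_single_pos htX j).le
      (sub_nonpos.2 (absDeriv_le (hcoop _ htX) _ j))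
  · exact mul_neg_of_pos_of_neg (hgrad.fderiv_single_pos htX i) (sub_neg.2 hi)

end IsSolutionOn

/-! ### Nonwandering points -/

theorem eq_zero_of_isNonwandering (hX : IsOpen X) (hf : ContDiffOn ℝ 1 f X)
    (hcoop : IsCooperative X f) (hirr : IsIrreducibleSystem X f) (hH : ContDiffOn ℝ 1 H X)
    (hint : IsFirstIntegral X f H) (hgrad : HasPositiveGradient X H) {x : Euc n} (hx : x ∈ X)
    (hnw : IsNonwandering X f x) : f x = 0 := by
  by_contra hfx
  obtain ⟨δ, hδ, α, hα, hαc⟩ := exists_local_flow hX hf hx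
  have hsx := hα.self_of_nhds
  have h0δ : (0 : ℝ) ∈ Ioo (-δ) δ := hsx.zero_mem
  obtain ⟨T, hT0, hTδ⟩ := exists_between hδ
  have hT : T ∈ Ioo (-δ) δ := ⟨by linarith, hTδ⟩
  have hT' : -T ∈ Ioo (-δ) δ := ⟨by linarith, by linarith⟩
  have hlt : weightedSpeed f H (α x T) < weightedSpeed f H x := by
    have := hsx.weightedSpeed_lt hX hf hcoop hirr hH hint hgrad h0δ hT hT0
      (by rwa [hsx.initial])
    rwa [hsx.initial] at this
  -- The level `c` separates the speeds near `x` from those reached at time `T` by orbits starting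
  -- near `x`; a returning orbit would have to climb back above `c`.
  obtain ⟨c, hc1, hc2⟩ := exists_between hlt
  have hev1 : ∀ᶠ y in 𝓝 x, weightedSpeed f H (α y T) < c :=
    ((continuousAt_weightedSpeed hX hf hH (hsx.mapsTo hT)).comp
      (f := fun y ↦ α y T) (hαc T hT)).eventually_lt
      continuousAt_const hc1
  have hev2 : ∀ᶠ y in 𝓝 x, c < weightedSpeed f H y :=
    continuousAt_const.eventually_lt (continuousAt_weightedSpeed hX hf hH hx) hc2
  obtain ⟨ε, hε, hball⟩ := Metric.eventually_nhds_iff_ball.1 (hα.and (hev1.and hev2))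
  have hmem : ∀ y : Euc n, ‖x - y‖ < ε → y ∈ Metric.ball x ε := fun y hy ↦ by
    rwa [mem_ball_iff_norm, norm_sub_rev]
  rcases hnw with ⟨-, hfw⟩ | ⟨-, hbw⟩
  · obtain ⟨y, -, -, θ, hTθ, hθ, hxy, hxz⟩ := hfw ε hε T hT0 (hsx.lt_exitTime hT)
    obtain ⟨J, γ, hγ, hθJ⟩ := exists_isSolutionOn_of_lt_exitTime (hT0.trans hTθ).le hθ
    rw [hγ.flow_eq hX hf hθJ] at hxz
    obtain ⟨hys, hy1, -⟩ := hball y (hmem y hxy)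
    obtain ⟨-, -, hz2⟩ := hball _ (hmem _ hxz)
    have hTJ : T ∈ J := hγ.ordConnected.out hγ.zero_mem hθJ ⟨hT0.le, hTθ.le⟩
    have hle := hγ.antitoneOn_weightedSpeed hX hf hcoop hH hint hgrad hTJ hθJ hTθ.le
    simp only [hγ.eqOn hX hf hys ⟨hTJ, hT⟩] at hle
    linarith
  · obtain ⟨y, -, -, θ, hθ, hTθ, hxy, hxz⟩ :=
      hbw ε hε (-T) (by linarith) (hsx.entryTime_lt hT')
    obtain ⟨J, γ, hγ, hθJ⟩ := exists_isSolutionOn_of_entryTime_lt (by linarith) hθ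
    rw [hγ.flow_eq hX hf hθJ] at hxz
    obtain ⟨-, -, hy2⟩ := hball y (hmem y hxy)
    obtain ⟨hzs, hz1, -⟩ := hball _ (hmem _ hxz)
    -- Here the orbit is read forward from `γ θ`, which is near `x`: after time `T` it is below `c`,
    -- yet at time 0 > `T + θ` it is at `y`, above `c`.
    have hTJ : T + θ ∈ J :=
      hγ.ordConnected.out hθJ hγ.zero_mem ⟨by linarith, by linarith⟩
    have hle := hγ.antitoneOn_weightedSpeed hX hf hcoop hH hint hgrad hTJ hγ.zero_mem
      (by linarith)
    have heq : γ (T + θ) = α (γ θ) T := (hγ.shift hθJ).eqOn hX hf hzs ⟨hTJ, hT⟩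
    simp only [heq, hγ.initial] at hle
    linarith

end CoopODE

theorem theorem7 (n : ℕ) (X : Set (CoopODE.Euc n)) (hX : IsOpen X)
    (f : CoopODE.Euc n → CoopODE.Euc n) (hf : ContDiffOn ℝ 1 f X)
    (hcoop : CoopODE.IsCooperative X f) (hirr : CoopODE.IsIrreducibleSystem X f)
    (H : CoopODE.Euc n → ℝ) (hH : ContDiffOn ℝ 1 H X)
    (hint : CoopODE.IsFirstIntegral X f H) (hgrad : CoopODE.HasPositiveGradient X H) :
    ∀ x : CoopODE.Euc n, CoopODE.IsNonwandering X f x → CoopODE.IsEquilibrium X f x := by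
  intro x hnw
  have hx : x ∈ X := hnw.elim (fun h ↦ h.1) fun h ↦ h.1
  exact CoopODE.isEquilibrium_of_eq_zero hX hf hx
    (CoopODE.eq_zero_of_isNonwandering hX hf hcoop hirr hH hint hgrad hx hnw)
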